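/- Let $m$ be normalized Lebesgue measure on the unit circle $\mathbb T$, let $H^2\subset L^2(\mathbb T,m)$ and $H^\infty\subset L^\infty(\mathbb T,m)$ be the Hardy spaces (functions whose Fourier coefficients of negative index vanish), and put $\chi(\zeta)=\zeta$. A function $u\in H^\infty$ is inner if $|u|=1$ a.e. on $\mathbb T$, and $g_e\in H^\infty$ is outer if the linear span of $\{\chi^n g_e : n\ge 0\}$ is dense in $H^2$. For an inner function $u$ let $\mathcal K_u=H^2\ominus uH^2$ be the model space, and for a closed subspace $\mathcal M$ let $P_{\mathcal M}$ be the orthogonal projection onto $\mathcal M$. An inner function $u$ divides an inner function $v$ if $v=uw$ for some inner function $w$. Let $\theta$ and $\omega$ be inner functions, let $g\in H^\infty$, and let $X\in\mathcal L(\mathcal K_\theta,\mathcal K_\omega)$ be the asymmetric truncated Toeplitz operator $Xf=P_{\mathcal K_\omega}(gf)$, $f\in\mathcal K_\theta$. (1) Suppose $g\ne 0$, let $g=g_ig_e$ be its inner-outer factorization ($g_i$ inner, $g_e$ outer), and let $\alpha$ be a greatest common divisor of the inner functions $g_i$ and $\omega$, that is, $\alpha$ is an inner function which divides $g_i$ and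 $\omega$ and is divisible by every inner function that divides both. Then $$\ker X=\mathcal K_\theta\cap\overline\alpha\omega H^2 .$$ If, moreover, $\operatorname{clos}(\mathcal K_\theta+\overline\alpha\omega H^2)=H^2$, then $$\operatorname{clos}X\mathcal K_\theta=\alpha\,\mathcal K_{\overline\alpha\omega}.$$ (2) Suppose $1/g\in H^\infty$. Then $X\mathcal K_\theta=\mathcal K_\omega$ if and only if $H^2=\mathcal K_\theta+\omega H^2$; and $X$ is invertible (it has a bounded inverse in $\mathcal L(\mathcal K_\omega,\mathcal K_\theta)$) if and only if $H^2=\mathcal K_\theta\dotplus\omega H^2$, i.e. $H^2=\mathcal K_\theta+\omega H^2$ and $\mathcal K_\theta\cap\omega H^2=\{0\}$. In that case $$X^{-1}f=\mathcal P_{\mathcal K_\theta\|\omega H^2}\bigl((1/g)f\bigr),\qquad f\in\mathcal K_\omega,$$ where $\mathcal P_{\mathcal K_\theta\|\omega H^2}$ is the (not necessarily orthogonal) projection of $H^2$ onto $\mathcal K_\theta$ parallel to $\omega H^2$. -/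

import Mathlib

open MeasureTheory AddCircle
open scoped ENNReal

namespace ModelSpaces

/-- Normalized Lebesgue measure `m` on the unit circle `𝕋`. The circle is parametrized as `ℝ / ℤ`,
`t ↦ exp (2πit)`, so that the function `χ ^ n` (`χ(ζ) = ζ`) on `𝕋` is `fourier n`. -/
noncomputable abbrev m : Measure UnitAddCircle := haarAddCircle

/-- `L²(𝕋, m)`. -/
noncomputable abbrev L2 : Type := Lp ℂ 2 m

/-- `L^∞(𝕋, m)`. -/
noncomputable abbrev Linf : Type := Lp ℂ ∞ m

/-- Multiplication by `u ∈ L^∞`, as a bounded operator on `L²(𝕋, m)`. -/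
noncomputable def mulOp (u : Linf) : L2 →L[ℂ] L2 :=
  (ContinuousLinearMap.mul ℂ ℂ).holderL m ∞ 2 2 u

/-- The operator `mulOp u` is pointwise multiplication almost everywhere. -/
theorem coeFn_mulOp (u : Linf) (f : L2) : mulOp u f =ᵐ[m] fun t => u t * f t :=
  (ContinuousLinearMap.mul ℂ ℂ).coeFn_holder (r := 2) u f

/-- The product `u v` in `L^∞(𝕋, m)`. -/
noncomputable def mulInf (u v : Linf) : Linf :=
  (ContinuousLinearMap.mul ℂ ℂ).holderL m ∞ ∞ ∞ u v

/-- The product `mulInf u v` is the pointwise product almost everywhere. -/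
theorem coeFn_mulInf (u v : Linf) : mulInf u v =ᵐ[m] fun t => u t * v t :=
  (ContinuousLinearMap.mul ℂ ℂ).coeFn_holder (r := ∞) u v

/-- The Hardy space `H²`, as the space of boundary functions: the `f ∈ L²(𝕋, m)` whose Fourier
coefficients of negative index vanish. -/
noncomputable def hardy : Submodule ℂ L2 where
  carrier := {f | ∀ n : ℤ, n < 0 → fourierCoeff (f : UnitAddCircle → ℂ) n = 0}
  zero_mem' := by
    intro n _
    rw [← fourierBasis_repr]
    simp
  add_mem' := by
    intro f g hf hg n hn
    have h1 := hf n hn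
    have h2 := hg n hn
    rw [← fourierBasis_repr] at h1 h2 ⊢
    simp [h1, h2]
  smul_mem' := by
    intro c f hf n hn
    have h1 := hf n hn
    rw [← fourierBasis_repr] at h1 ⊢
    simp [h1]

theorem isClosed_hardy : IsClosed (hardy : Set L2) := by
  have h : (hardy : Set L2) = ⋂ n : ℤ, ⋂ _ : n < 0,
      {f : L2 | inner ℂ (fourierBasis (T := 1) n) f = 0} := by
    ext f
    simp only [Set.mem_iInter, Set.mem_ofPred_eq, SetLike.mem_coe]
    refine forall₂_congr fun n _ => ?_
    rw [← HilbertBasis.repr_apply_apply, fourierBasis_repr]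
  rw [h]
  refine isClosed_iInter fun n => isClosed_iInter fun _ => ?_
  exact isClosed_eq (continuous_const.inner continuous_id) continuous_const

/-- `g ∈ H^∞`, as a boundary function: `g ∈ L^∞(𝕋, m)` and the Fourier coefficients of `g` of
negative index vanish. -/
def IsHinf (g : Linf) : Prop :=
  ∀ n : ℤ, n < 0 → fourierCoeff (g : UnitAddCircle → ℂ) n = 0

/-- Inner functions: functions in `H^∞` that are unimodular a.e. on `𝕋`. -/
def IsInner (u : Linf) : Prop :=
  IsHinf u ∧ ∀ᵐ t ∂m, ‖u t‖ = 1

/-- (Bounded) outer functions: functions `g ∈ H^∞` such that the products `χ ^ n g`, `n ≥ 0`, span a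
dense subspace of `H²`. -/
def IsOuter (g : Linf) : Prop :=
  IsHinf g ∧
    (Submodule.span ℂ (Set.range fun n : ℕ =>
      mulOp g (fourierLp 2 (n : ℤ)))).topologicalClosure = hardy

/-- `u` is the inner factor of `g` in the inner-outer factorization `g = u g_e` of `g ∈ H^∞`
(it is unique up to a unimodular constant). -/
def IsInnerFactor (u g : Linf) : Prop :=
  IsInner u ∧ ∃ ge : Linf, IsOuter ge ∧ g = mulInf u ge

/-- `u` divides `v` among inner functions. -/
def InnerDvd (u v : Linf) : Prop :=
  ∃ w : Linf, IsInner w ∧ v = mulInf u w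

/-- `a` is a greatest common divisor of the inner functions `u` and `v`
(it is unique up to a unimodular constant). -/
def IsInnerGcd (a u v : Linf) : Prop :=
  IsInner a ∧ InnerDvd a u ∧ InnerDvd a v ∧
    ∀ d : Linf, IsInner d → InnerDvd d u → InnerDvd d v → InnerDvd d a

/-- `u H² = {u h : h ∈ H²}`. -/
noncomputable def mulHardy (u : Linf) : Submodule ℂ L2 :=
  hardy.map (mulOp u).toLinearMap

/-- The model space `K_u = H² ⊖ u H²`. -/
noncomputable def modelSpace (u : Linf) : Submodule ℂ L2 :=
  hardy ⊓ (mulHardy u)ᗮ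

instance completeSpace_modelSpace (u : Linf) : CompleteSpace (modelSpace u) :=
  (isClosed_hardy.inter (mulHardy u).isClosed_orthogonal).completeSpace_coe

/-- The asymmetric truncated Toeplitz operator `K_θ → K_ω`, `f ↦ P_{K_ω} (g f)`, where `P_{K_ω}` is
the orthogonal projection of `L²(𝕋, m)` on `K_ω`. -/
noncomputable def toeplitz (θ ω g : Linf) : modelSpace θ →L[ℂ] modelSpace ω :=
  (modelSpace ω).orthogonalProjectionOnto ∘L mulOp g ∘L (modelSpace θ).subtypeL

/-- The direct sum decomposition `H² = K_θ ∔ ω H²` (not necessarily orthogonal): the subspaces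
`K_θ` and `ω H²` of `H²` are complementary in `H²`. -/
def IsDirectDecomp (θ ω : Linf) : Prop :=
  IsCompl ((modelSpace θ).submoduleOf hardy) ((mulHardy ω).submoduleOf hardy)

/-- If `H² = K_θ ∔ ω H²`, the projection of `H²` on `K_θ` parallel to `ω H²`. -/
noncomputable def skewProj {θ ω : Linf} (h : IsDirectDecomp θ ω) : hardy →ₗ[ℂ] hardy :=
  Submodule.projection ((modelSpace θ).submoduleOf hardy) ((mulHardy ω).submoduleOf hardy) h

end ModelSpaces

namespace ModelSpaces

/-! ### Multiplication operators -/

/-! Since `g f` lies in `H²`, `X f = y` is the congruence `g f ≡ y` modulo `ω H²`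
(`toeplitz_apply_eq_iff`); both halves rest on this.

(1) Write `ω = α b` and `g = α a ge`, with `a`, `b` coprime and `ge` outer. After cancelling `α`, `X
f = 0` reads `a ge f ∈ b H²`, and coprimality and outerness strip off `a` and `ge`, leaving `f ∈ b
H²`. For the range, `X f = α P (a ge f)` with `P` the projection on `K_b`; a vector `α y`, `y ∈
K_b`, orthogonal to the range has `y` orthogonal to `a H²` as well as to `b H²`, so `y = 0`. The
analytic input is that coprime `a`, `b` have `a H² + b H²` dense in `H²`
(`IsInnerGcd.inner_eq_zero`), which comes from Beurling's theorem.

(2) If `g` and `1/g` are in `H^∞`, both preserve `ω H²`, so the congruence becomes `f ≡ (1/g) y`.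
Solvability and uniqueness in `K_θ` are then statements about `K_θ` and `ω H²` alone. -/

theorem mulOp_congr {u v : Linf} {f g : L2} (h : (fun t => u t * f t) =ᵐ[m] fun t => v t * g t) :
    mulOp u f = mulOp v g :=
  Lp.ext ((coeFn_mulOp u f).trans (h.trans (coeFn_mulOp v g).symm))

theorem mulOp_mulInf (u v : Linf) (f : L2) : mulOp (mulInf u v) f = mulOp u (mulOp v f) := by
  refine mulOp_congr ?_
  filter_upwards [coeFn_mulInf u v, coeFn_mulOp v f] with t h1 h2
  rw [h1, h2, mul_assoc]

theorem mulInf_comm (u v : Linf) : mulInf u v = mulInf v u := by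
  refine Lp.ext ?_
  filter_upwards [coeFn_mulInf u v, coeFn_mulInf v u] with t h1 h2
  rw [h1, h2, mul_comm]

theorem mulOp_comm (u v : Linf) (f : L2) : mulOp u (mulOp v f) = mulOp v (mulOp u f) := by
  rw [← mulOp_mulInf, mulInf_comm, mulOp_mulInf]

theorem mulInf_assoc (u v w : Linf) : mulInf (mulInf u v) w = mulInf u (mulInf v w) := by
  refine Lp.ext ?_
  filter_upwards [coeFn_mulInf u v, coeFn_mulInf v w, coeFn_mulInf (mulInf u v) w,
    coeFn_mulInf u (mulInf v w)] with t h1 h2 h3 h4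
  rw [h3, h4, h1, h2, mul_assoc]

theorem inner_mulOp_left (u : Linf) (f g : L2) :
    inner ℂ (mulOp u f) g = inner ℂ f (mulOp (star u) g) := by
  rw [L2.inner_def, L2.inner_def]
  refine integral_congr_ae ?_
  filter_upwards [coeFn_mulOp u f, coeFn_mulOp (star u) g, Lp.coeFn_star u] with t h1 h2 h3
  rw [h1, h2, h3]
  simp only [RCLike.inner_apply, map_mul, Pi.star_apply, RCLike.star_def]
  ring

theorem inner_mulOp_right (u : Linf) (f g : L2) :
    inner ℂ f (mulOp u g) = inner ℂ (mulOp (star u) f) g := by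
  rw [inner_mulOp_left, star_star]

theorem mulOp_fourierLp (n k : ℤ) :
    mulOp (fourierLp ∞ n) (fourierLp 2 k) = fourierLp 2 (n + k) := by
  refine Lp.ext ((coeFn_mulOp _ _).trans ?_)
  filter_upwards [coeFn_fourierLp (T := 1) ∞ n, coeFn_fourierLp (T := 1) 2 k,
    coeFn_fourierLp (T := 1) 2 (n + k)] with t h1 h2 h3
  rw [h1, h2, h3, fourier_add]

theorem star_fourierLp (n : ℤ) :
    star (fourierLp ∞ n : Linf) = fourierLp ∞ (-n) := by
  refine Lp.ext ((Lp.coeFn_star _).trans ?_)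
  filter_upwards [coeFn_fourierLp (T := 1) ∞ n, coeFn_fourierLp (T := 1) ∞ (-n)] with t h1 h2
  rw [Pi.star_apply, h1, h2, fourier_neg, RCLike.star_def]

theorem coeFn_mulOp_fourierLp_zero (u : Linf) : mulOp u (fourierLp 2 0) =ᵐ[m] u := by
  filter_upwards [coeFn_mulOp u (fourierLp 2 0), coeFn_fourierLp (T := 1) 2 0] with t h1 h2
  rw [h1, h2, fourier_zero, mul_one]

/-- A bounded function is recovered from its action on the constant `1`, so identities in `L^∞` can
be checked for operators on `L²`. -/
theorem linf_ext {u v : Linf} (h : mulOp u (fourierLp 2 0) = mulOp v (fourierLp 2 0)) : u = v :=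
  Lp.ext ((coeFn_mulOp_fourierLp_zero u).symm.trans (h ▸ coeFn_mulOp_fourierLp_zero v))

/-- Moving the conjugate of a factor through the inner product. -/
theorem inner_mulOp_star_fourierLp (u : Linf) (w : L2) (n k : ℤ) :
    inner ℂ (mulOp (fourierLp ∞ n) (star w)) (mulOp u (fourierLp 2 k)) =
      inner ℂ (fourierLp 2 (n - k)) (mulOp u w) := by
  rw [L2.inner_def, L2.inner_def]
  refine integral_congr_ae ?_
  filter_upwards [coeFn_mulOp u w, coeFn_mulOp u (fourierLp 2 k), Lp.coeFn_star w,
    coeFn_mulOp (fourierLp ∞ n) (star w), coeFn_fourierLp (T := 1) ∞ n,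
    coeFn_fourierLp (T := 1) 2 k, coeFn_fourierLp (T := 1) 2 (n - k)] with t h1 h2 h3 h4 h5 h6 h7
  rw [h1, h2, h4, h3, h5, h6, h7, sub_eq_add_neg, fourier_add, fourier_neg]
  simp only [RCLike.inner_apply, map_mul, Pi.star_apply, RCLike.star_def, Complex.conj_conj]
  ring

/-! ### The Hardy space -/

theorem fourierCoeff_eq_inner (f : L2) (n : ℤ) :
    fourierCoeff (f : UnitAddCircle → ℂ) n = inner ℂ (fourierLp 2 n) f := by
  rw [← fourierBasis_repr, HilbertBasis.repr_apply_apply, coe_fourierBasis]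

theorem mem_hardy_iff {f : L2} :
    f ∈ hardy ↔ ∀ n : ℤ, n < 0 → inner ℂ (fourierLp 2 n) f = 0 :=
  forall₂_congr fun n _ => by rw [fourierCoeff_eq_inner]

theorem isHinf_iff {u : Linf} : IsHinf u ↔ mulOp u (fourierLp 2 0) ∈ hardy :=
  forall₂_congr fun n _ => by rw [fourierCoeff_congr_ae (coeFn_mulOp_fourierLp_zero u)]

theorem inner_fourierLp (n k : ℤ) :
    inner ℂ (fourierLp 2 n : L2) (fourierLp 2 k) = if n = k then 1 else 0 :=
  (orthonormal_iff_ite.mp (orthonormal_fourier (T := 1))) n k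

theorem fourierLp_mem_hardy {n : ℤ} (hn : 0 ≤ n) : (fourierLp 2 n : L2) ∈ hardy :=
  mem_hardy_iff.mpr fun k hk => by rw [inner_fourierLp, if_neg (by omega)]

theorem eq_zero_of_inner_fourierLp {f : L2} (h : ∀ n : ℤ, inner ℂ (fourierLp 2 n) f = 0) :
    f = 0 := by
  refine fourierBasis.repr.injective ?_
  ext n
  rw [HilbertBasis.repr_apply_apply, coe_fourierBasis, h n]
  simp

/-- A function orthogonal to all `χ ^ k`, `k ≥ 0`, is orthogonal to `H²`. -/
theorem inner_eq_zero_of_mem_hardy {v f : L2}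
    (hv : ∀ k : ℤ, 0 ≤ k → inner ℂ v (fourierLp 2 k) = 0) (hf : f ∈ hardy) :
    inner ℂ v f = 0 := by
  rw [← fourierBasis.tsum_inner_mul_inner v f]
  simp only [coe_fourierBasis]
  convert tsum_zero with k
  rcases le_or_gt 0 k with hk | hk
  · rw [hv k hk, zero_mul]
  · rw [mem_hardy_iff.mp hf k hk, mul_zero]

theorem inner_mulOp_eq_zero_of_mem_hardy {v f : L2} (u : Linf)
    (hv : ∀ k : ℤ, 0 ≤ k → inner ℂ v (mulOp u (fourierLp 2 k)) = 0) (hf : f ∈ hardy) :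
    inner ℂ v (mulOp u f) = 0 := by
  rw [inner_mulOp_right]
  exact inner_eq_zero_of_mem_hardy (fun k hk => by rw [← inner_mulOp_right, hv k hk]) hf

theorem inner_fourierLp_mulOp (u : Linf) (n k : ℤ) (f : L2) :
    inner ℂ (fourierLp 2 n) (mulOp u (mulOp (fourierLp ∞ k) f)) =
      inner ℂ (fourierLp 2 (n - k)) (mulOp u f) := by
  rw [mulOp_comm, inner_mulOp_right, star_fourierLp, mulOp_fourierLp, neg_add_eq_sub]

/-- `H²` is invariant under multiplication by functions in `H^∞`. -/
theorem mulOp_mem_hardy {u : Linf} (hu : IsHinf u) {f : L2} (hf : f ∈ hardy) :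
    mulOp u f ∈ hardy := by
  refine mem_hardy_iff.mpr fun n hn => inner_mulOp_eq_zero_of_mem_hardy u (fun k hk => ?_) hf
  have := inner_fourierLp_mulOp u n k (fourierLp 2 0)
  rw [mulOp_fourierLp, add_zero] at this
  rw [this]
  exact mem_hardy_iff.mp (isHinf_iff.mp hu) _ (by omega)

theorem isHinf_mulInf {u v : Linf} (hu : IsHinf u) (hv : IsHinf v) : IsHinf (mulInf u v) := by
  rw [isHinf_iff, mulOp_mulInf]
  exact mulOp_mem_hardy hu (isHinf_iff.mp hv)

theorem isHinf_fourierLp {n : ℤ} (hn : 0 ≤ n) : IsHinf (fourierLp ∞ n) := by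
  rw [isHinf_iff, mulOp_fourierLp, add_zero]
  exact fourierLp_mem_hardy hn

/-- If the products `u w` with `u` in some family lie in `H²` and no function is orthogonal to all
`u H²` but not to `1`, then `w` lies in `H²`. -/
theorem mem_hardy_of_mulOp_mem {S : Set Linf} {w : L2} (hw : ∀ u ∈ S, mulOp u w ∈ hardy)
    (hS : ∀ v : L2, (∀ u ∈ S, ∀ k : ℤ, 0 ≤ k → inner ℂ v (mulOp u (fourierLp 2 k)) = 0) →
      inner ℂ v (fourierLp 2 0) = 0) :
    w ∈ hardy := by
  refine mem_hardy_iff.mpr fun n hn => ?_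
  -- The test vector `χ ^ n * conj w` turns its pairing with `u χ ^ k` into the Fourier coefficient
  -- of `u w` at `n - k < 0`.
  have h := hS (mulOp (fourierLp ∞ n) (star w)) fun u hu k hk => by
    rw [inner_mulOp_star_fourierLp]
    exact mem_hardy_iff.mp (hw u hu) _ (by omega)
  -- The case `u = 1`, `k = 0` of the same identity: pairing with `1` gives the coefficient of `w`
  -- itself at `n`.
  have h1 := inner_mulOp_star_fourierLp (fourierLp ∞ 0) w n 0
  rw [mulOp_fourierLp, add_zero, h, inner_mulOp_right, star_fourierLp, mulOp_fourierLp] at h1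
  simpa using h1.symm

/-! ### Inner functions -/

theorem IsInner.mulOp_star_mulOp {u : Linf} (hu : IsInner u) (f : L2) :
    mulOp (star u) (mulOp u f) = f := by
  refine Lp.ext ((coeFn_mulOp _ _).trans ?_)
  filter_upwards [coeFn_mulOp u f, Lp.coeFn_star u, hu.2] with t h1 h2 h3
  rw [h1, h2, Pi.star_apply, ← mul_assoc, RCLike.star_def, Complex.conj_mul', h3]
  simp

theorem IsInner.mulOp_mulOp_star {u : Linf} (hu : IsInner u) (f : L2) :
    mulOp u (mulOp (star u) f) = f := by
  rw [mulOp_comm, hu.mulOp_star_mulOp]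

theorem IsInner.mulOp_injective {u : Linf} (hu : IsInner u) : Function.Injective (mulOp u) :=
  Function.LeftInverse.injective hu.mulOp_star_mulOp

theorem IsInner.inner_mulOp {u : Linf} (hu : IsInner u) (f g : L2) :
    inner ℂ (mulOp u f) (mulOp u g) = inner ℂ f g := by
  rw [inner_mulOp_left, hu.mulOp_star_mulOp]

theorem isInner_mulInf {u v : Linf} (hu : IsInner u) (hv : IsInner v) : IsInner (mulInf u v) := by
  refine ⟨isHinf_mulInf hu.1 hv.1, ?_⟩
  filter_upwards [hu.2, hv.2, coeFn_mulInf u v] with t h1 h2 h3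
  rw [h3, norm_mul, h1, h2, one_mul]

theorem IsInner.star_mulInf_cancel {u : Linf} (hu : IsInner u) (v : Linf) :
    mulInf (star u) (mulInf u v) = v := by
  refine linf_ext ?_
  rw [mulOp_mulInf, mulOp_mulInf, hu.mulOp_star_mulOp]

theorem mem_mulHardy_iff {u : Linf} (hu : IsInner u) {f : L2} :
    f ∈ mulHardy u ↔ mulOp (star u) f ∈ hardy := by
  constructor
  · rintro ⟨h, hh, rfl⟩
    simpa [hu.mulOp_star_mulOp] using hh
  · exact fun h => ⟨_, h, hu.mulOp_mulOp_star f⟩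

theorem mulOp_mem_mulHardy (u : Linf) {f : L2} (hf : f ∈ hardy) : mulOp u f ∈ mulHardy u :=
  ⟨f, hf, rfl⟩

theorem mulHardy_le_hardy {u : Linf} (hu : IsHinf u) : mulHardy u ≤ hardy := by
  rintro _ ⟨h, hh, rfl⟩
  exact mulOp_mem_hardy hu hh

theorem mulOp_mem_mulHardy_of_isHinf {u v : Linf} (hv : IsHinf v) {f : L2}
    (hf : f ∈ mulHardy u) : mulOp v f ∈ mulHardy u := by
  obtain ⟨h, hh, rfl⟩ := hf
  exact ⟨_, mulOp_mem_hardy hv hh, mulOp_comm u v h⟩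

theorem isClosed_mulHardy {u : Linf} (hu : IsInner u) : IsClosed (mulHardy u : Set L2) := by
  have : (mulHardy u : Set L2) = mulOp (star u) ⁻¹' hardy := by
    ext f
    exact mem_mulHardy_iff hu
  rw [this]
  exact isClosed_hardy.preimage (mulOp (star u)).continuous

theorem innerDvd_of_mulOp_mem {u v : Linf} (hu : IsInner u) (hv : IsInner v)
    (h : mulOp v (fourierLp 2 0) ∈ mulHardy u) : InnerDvd u v := by
  refine ⟨mulInf (star u) v, ⟨?_, ?_⟩, linf_ext ?_⟩
  · rw [isHinf_iff, mulOp_mulInf]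
    exact (mem_mulHardy_iff hu).mp h
  · filter_upwards [hu.2, hv.2, coeFn_mulInf (star u) v, Lp.coeFn_star u] with t h1 h2 h3 h4
    rw [h3, h4, Pi.star_apply, norm_mul, norm_star, h1, h2, one_mul]
  · rw [mulOp_mulInf, mulOp_mulInf, hu.mulOp_mulOp_star]

/-! ### Beurling's theorem -/

/-- A finite measure on the circle is determined by its Fourier coefficients. -/
theorem measure_ext_of_integral_fourier {μ ν : Measure UnitAddCircle} [IsFiniteMeasure μ]
    [IsFiniteMeasure ν] (h : ∀ n : ℤ, ∫ t, fourier n t ∂μ = ∫ t, fourier n t ∂ν) : μ = ν := by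
  have key : ∀ f ∈ Submodule.span ℂ (Set.range (fourier (T := 1))),
      ∫ t, f t ∂μ = ∫ t, f t ∂ν := by
    intro f hf
    have hint : ∀ (f : C(UnitAddCircle, ℂ)) (ρ : Measure UnitAddCircle) [IsFiniteMeasure ρ],
        Integrable f ρ := fun f ρ _ => f.continuous.integrable_of_hasCompactSupport
          (HasCompactSupport.of_compactSpace f)
    induction hf using Submodule.span_induction with
    | mem f hf => obtain ⟨n, rfl⟩ := hf; exact h n
    | zero => simp
    | add f g _ _ hf hg =>
      simp only [ContinuousMap.add_apply]
      rw [integral_add (hint f μ) (hint g μ), integral_add (hint f ν) (hint g ν), hf, hg]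
    | smul c f _ hf =>
      simp only [ContinuousMap.smul_apply]
      rw [integral_smul, integral_smul, hf]
  refine ext_of_forall_mem_subalgebra_integral_eq_of_polish (𝕜 := ℂ)
    (A := (fourierSubalgebra (T := 1)).comap
      (BoundedContinuousFunction.toContinuousMapStarₐ ℂ)) ?_ ?_
  · intro x y hxy
    obtain ⟨_, ⟨f, hf, rfl⟩, hne⟩ := fourierSubalgebra_separatesPoints hxy
    exact ⟨f, ⟨f, ⟨BoundedContinuousFunction.mkOfCompact f, hf, rfl⟩, rfl⟩, hne⟩
  · intro g hg
    refine key (BoundedContinuousFunction.toContinuousMapStarₐ ℂ g) ?_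
    rw [← fourierSubalgebra_coe]
    exact hg

/-- The hypotheses say that the measure `|φ|² m` has the Fourier coefficients of `m`; hence the two
measures agree, and so do their densities. -/
theorem norm_eq_one_of_inner_fourierLp_mulOp {φ : L2} (hφ : ‖φ‖ = 1)
    (h : ∀ n : ℤ, n ≠ 0 → inner ℂ φ (mulOp (fourierLp ∞ n) φ) = 0) :
    ∀ᵐ t ∂m, ‖φ t‖ = 1 := by
  have hmeas : AEMeasurable (fun t => ‖φ t‖ₑ ^ 2) m :=
    ((Lp.aestronglyMeasurable φ).enorm).pow_const 2
  have hfin : ∫⁻ t, ‖φ t‖ₑ ^ 2 ∂m ≠ ∞ := by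
    have := (Lp.memLp φ).eLpNorm_lt_top
    rw [eLpNorm_lt_top_iff_lintegral_rpow_enorm_lt_top (by simp) (by simp)] at this
    simpa using this.ne
  have : IsFiniteMeasure (m.withDensity fun t => ‖φ t‖ₑ ^ 2) := isFiniteMeasure_withDensity hfin
  have hm : m.withDensity (fun t => ‖φ t‖ₑ ^ 2) = m.withDensity 1 := by
    rw [withDensity_one]
    refine measure_ext_of_integral_fourier fun n => ?_
    rw [integral_withDensity_eq_integral_toReal_smul₀ hmeas (ae_of_all _ fun t => by simp)]
    have h1 : ∫ t, (‖φ t‖ₑ ^ 2).toReal • fourier n t ∂m =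
        inner ℂ φ (mulOp (fourierLp ∞ n) φ) := by
      rw [L2.inner_def]
      refine integral_congr_ae ?_
      filter_upwards [coeFn_mulOp (fourierLp ∞ n) φ, coeFn_fourierLp (T := 1) ∞ n] with t h1 h2
      rw [h1, h2, RCLike.inner_apply, mul_assoc, RCLike.mul_conj, Complex.real_smul, mul_comm]
      simp
    have h2 : ∫ t, fourier n t ∂m = inner ℂ (fourierLp 2 0 : L2) (fourierLp 2 n) := by
      rw [L2.inner_def]
      refine integral_congr_ae ?_
      filter_upwards [coeFn_fourierLp (T := 1) 2 0, coeFn_fourierLp (T := 1) 2 n] with t h1 h2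
      rw [h1, h2, RCLike.inner_apply, fourier_zero]
      simp
    rw [h1, h2, inner_fourierLp]
    rcases eq_or_ne n 0 with rfl | hn
    · have : mulOp (fourierLp ∞ 0) φ = φ := by
        refine Lp.ext ((coeFn_mulOp _ _).trans ?_)
        filter_upwards [coeFn_fourierLp (T := 1) ∞ 0] with t ht
        rw [ht, fourier_zero, one_mul]
      rw [this, inner_self_eq_norm_sq_to_K, hφ]
      simp
    · rw [h n hn, if_neg hn.symm]
  rw [withDensity_eq_iff hmeas (by fun_prop) hfin] at hm
  filter_upwards [hm] with t ht
  have h1 : ‖φ t‖ ^ 2 = 1 := by simpa using congrArg ENNReal.toReal ht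
  exact (pow_eq_one_iff_of_nonneg (norm_nonneg _) two_ne_zero).mp h1

theorem isInner_fourierLp {n : ℤ} (hn : 0 ≤ n) : IsInner (fourierLp ∞ n) := by
  refine ⟨isHinf_fourierLp hn, ?_⟩
  filter_upwards [coeFn_fourierLp (T := 1) ∞ n] with t ht
  rw [ht, fourier_apply, Circle.norm_coe]

theorem mulOp_fourierLp_mulOp_fourierLp (n k : ℤ) (f : L2) :
    mulOp (fourierLp ∞ n) (mulOp (fourierLp ∞ k) f) = mulOp (fourierLp ∞ (n + k)) f := by
  rw [← mulOp_mulInf]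
  congr 1
  congr 1
  exact linf_ext (by
    rw [mulOp_mulInf, mulOp_fourierLp, mulOp_fourierLp, mulOp_fourierLp, add_assoc])

/-- A nonzero closed subspace `M` of `H²` invariant under `χ` has a unit vector orthogonal to
`χ M`. -/
theorem exists_wandering_vector {M : Submodule ℂ L2} (hM : IsClosed (M : Set L2))
    (hle : M ≤ hardy) (hne : M ≠ ⊥) (hinv : ∀ f ∈ M, mulOp (fourierLp ∞ 1) f ∈ M) :
    ∃ φ ∈ M, ‖φ‖ = 1 ∧ ∀ f ∈ M, inner ℂ φ (mulOp (fourierLp ∞ 1) f) = 0 := by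
  have h1 : IsInner (fourierLp ∞ 1) := isInner_fourierLp zero_le_one
  set N : Submodule ℂ L2 := M.map (mulOp (fourierLp ∞ 1)).toLinearMap with hN
  have hNM : N ≤ M := by
    rintro _ ⟨f, hf, rfl⟩
    exact hinv f hf
  have hNc : IsClosed (N : Set L2) := by
    have : (N : Set L2) = mulOp (star (fourierLp ∞ 1)) ⁻¹' M := by
      ext f
      constructor
      · rintro ⟨g, hg, rfl⟩
        simpa [h1.mulOp_star_mulOp] using hg
      · exact fun h => ⟨_, h, h1.mulOp_mulOp_star f⟩
    rw [this]
    exact hM.preimage (mulOp _).continuous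
  have : CompleteSpace N := hNc.completeSpace_coe
  -- Otherwise `M = χ M`, hence `M = χ ^ n M` for all `n`, and every Fourier coefficient of every `f
  -- ∈ M` vanishes.
  have hlt : Nᗮ ⊓ M ≠ ⊥ := by
    intro hbot
    have hMN : N = M := by
      have := Submodule.sup_orthogonal_inf_of_hasOrthogonalProjection hNM
      rwa [hbot, sup_bot_eq] at this
    have hz : ∀ n : ℕ, ∀ f ∈ M, ∀ k : ℤ, k < n → inner ℂ (fourierLp 2 k) f = 0 := by
      intro n
      induction n with
      | zero => exact fun f hf k hk => mem_hardy_iff.mp (hle hf) k (by simpa using hk)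
      | succ n ih =>
        intro f hf k hk
        rw [← hMN] at hf
        obtain ⟨g, hg, rfl⟩ := hf
        have : inner ℂ (fourierLp 2 k) (mulOp (fourierLp ∞ 1) g) =
            inner ℂ (fourierLp 2 (k - 1)) g := by
          rw [inner_mulOp_right, star_fourierLp, mulOp_fourierLp, neg_add_eq_sub]
        exact this.trans (ih g hg _ (by push_cast at hk; omega))
    refine hne ((Submodule.eq_bot_iff _).mpr fun f hf => eq_zero_of_inner_fourierLp fun k => ?_)
    exact hz (k.toNat + 1) f hf k (by push_cast; omega)
  obtain ⟨ψ, hψ, hψ0⟩ := Submodule.exists_mem_ne_zero_of_ne_bot hlt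
  refine ⟨((‖ψ‖⁻¹ : ℝ) : ℂ) • ψ, M.smul_mem _ hψ.2, ?_, fun f hf => ?_⟩
  · rw [norm_smul, Complex.norm_real, norm_inv, norm_norm,
      inv_mul_cancel₀ (norm_ne_zero_iff.mpr hψ0)]
  · have : inner ℂ ψ (mulOp (fourierLp ∞ 1) f) = 0 :=
      Submodule.inner_left_of_mem_orthogonal (K := N) ⟨f, hf, rfl⟩ hψ.1
    rw [inner_smul_left, this, mul_zero]

/-- Beurling's theorem. -/
theorem exists_eq_mulHardy {M : Submodule ℂ L2} (hM : IsClosed (M : Set L2))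
    (hle : M ≤ hardy) (hne : M ≠ ⊥) (hinv : ∀ f ∈ M, mulOp (fourierLp ∞ 1) f ∈ M) :
    ∃ u : Linf, IsInner u ∧ M = mulHardy u := by
  obtain ⟨φ, hφM, hφ1, hφ⟩ := exists_wandering_vector hM hle hne hinv
  have hpow : ∀ (n : ℕ), ∀ f ∈ M, mulOp (fourierLp ∞ n) f ∈ M := by
    intro n f hf
    induction n with
    | zero =>
      have : mulOp (fourierLp ∞ ((0 : ℕ) : ℤ)) f = f := by
        refine Lp.ext ((coeFn_mulOp _ _).trans ?_)
        filter_upwards [coeFn_fourierLp (T := 1) ∞ ((0 : ℕ) : ℤ)] with t ht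
        rw [ht, Nat.cast_zero, fourier_zero, one_mul]
      rwa [this]
    | succ n ih =>
      rw [Nat.cast_succ, add_comm, ← mulOp_fourierLp_mulOp_fourierLp]
      exact hinv _ ih
  have hperp : ∀ n : ℤ, 0 < n → ∀ f ∈ M, inner ℂ φ (mulOp (fourierLp ∞ n) f) = 0 := by
    intro n hn f hf
    obtain ⟨k, rfl⟩ : ∃ k : ℕ, n = 1 + k := ⟨(n - 1).toNat, by omega⟩
    rw [← mulOp_fourierLp_mulOp_fourierLp]
    exact hφ _ (hpow k f hf)
  -- Negative `n` reduce to positive ones by conjugate symmetry.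
  have hnorm : ∀ᵐ t ∂m, ‖φ t‖ = 1 := by
    refine norm_eq_one_of_inner_fourierLp_mulOp hφ1 fun n hn => ?_
    rcases lt_or_gt_of_ne hn with hn | hn
    · rw [inner_mulOp_right, star_fourierLp, ← inner_conj_symm, hperp _ (by omega) _ hφM, map_zero]
    · exact hperp n hn _ hφM
  have hmem : MemLp φ ∞ m :=
    memLp_top_of_bound (Lp.aestronglyMeasurable φ) 1 (hnorm.mono fun t ht => ht.le)
  have hu : mulOp (hmem.toLp φ) (fourierLp 2 0) = φ :=
    Lp.ext ((coeFn_mulOp_fourierLp_zero _).trans hmem.coeFn_toLp)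
  have huk : ∀ k : ℤ, mulOp (hmem.toLp φ) (fourierLp 2 k) = mulOp (fourierLp ∞ k) φ := by
    intro k
    conv_rhs => rw [← hu, mulOp_comm, mulOp_fourierLp, add_zero]
  have hinner : IsInner (hmem.toLp φ) := by
    refine ⟨isHinf_iff.mpr (hu.symm.subst (motive := (· ∈ hardy)) (hle hφM)), ?_⟩
    filter_upwards [hnorm, hmem.coeFn_toLp] with t h1 h2
    rw [h2, h1]
  refine ⟨hmem.toLp φ, hinner, le_antisymm (fun f hf => ?_) ?_⟩
  -- For `n < 0`, the coefficient of `conj u * f` at `n` is `⟪φ, χ ^ (-n) f⟫`, which is zero by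
  -- `hperp`.
  · refine (mem_mulHardy_iff hinner).mpr (mem_hardy_iff.mpr fun n hn => ?_)
    rw [← inner_mulOp_left, huk, inner_mulOp_left, star_fourierLp]
    exact hperp _ (by omega) f hf
  · have : CompleteSpace M := hM.completeSpace_coe
    rintro _ ⟨h, hh, rfl⟩
    rw [← M.orthogonal_orthogonal]
    refine fun v hv => inner_mulOp_eq_zero_of_mem_hardy _ (fun k hk => ?_) hh
    rw [huk]
    obtain ⟨k, rfl⟩ := Int.eq_ofNat_of_zero_le hk
    exact Submodule.inner_left_of_mem_orthogonal (hpow k φ hφM) hv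

/-! ### Coprime inner functions and outer functions -/

/-- If `α` is a greatest common divisor of `α a` and `α b`, then no nonzero function in `H²` is
orthogonal to `a H² + b H²`. -/
theorem IsInnerGcd.inner_eq_zero {α a b : Linf} (ha : IsInner a) (hb : IsInner b)
    (h : IsInnerGcd α (mulInf α a) (mulInf α b)) {v : L2}
    (hva : ∀ k : ℤ, 0 ≤ k → inner ℂ v (mulOp a (fourierLp 2 k)) = 0)
    (hvb : ∀ k : ℤ, 0 ≤ k → inner ℂ v (mulOp b (fourierLp 2 k)) = 0)
    {f : L2} (hf : f ∈ hardy) : inner ℂ v f = 0 := by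
  obtain ⟨hα, -, -, hmax⟩ := h
  set M := (mulHardy a ⊔ mulHardy b).topologicalClosure with hMdef
  have he : (fourierLp 2 0 : L2) ∈ hardy := fourierLp_mem_hardy le_rfl
  have haM : mulOp a (fourierLp 2 0) ∈ M :=
    Submodule.le_topologicalClosure _ (Submodule.mem_sup_left (mulOp_mem_mulHardy a he))
  have hbM : mulOp b (fourierLp 2 0) ∈ M :=
    Submodule.le_topologicalClosure _ (Submodule.mem_sup_right (mulOp_mem_mulHardy b he))
  -- By Beurling the closure of `a H² + b H²` is `φ H²`; the gcd property will force `φ` to be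
  -- invertible in `H^∞`.
  obtain ⟨φ, hφ, hM⟩ := exists_eq_mulHardy (M := M)
    (Submodule.isClosed_topologicalClosure _)
    (Submodule.topologicalClosure_minimal _
      (sup_le (mulHardy_le_hardy ha.1) (mulHardy_le_hardy hb.1)) isClosed_hardy)
    (by
      intro hbot
      rw [hbot, Submodule.mem_bot, ← (mulOp a).map_zero] at haM
      exact (orthonormal_fourier (T := 1)).ne_zero 0 (ha.mulOp_injective haM))
    (by
      intro f hf
      refine map_mem_closure (mulOp (fourierLp ∞ 1)).continuous hf fun g hg => ?_
      obtain ⟨x, hx, y, hy, rfl⟩ := Submodule.mem_sup.mp (SetLike.mem_coe.mp hg)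
      rw [map_add]
      exact Submodule.add_mem_sup
        (mulOp_mem_mulHardy_of_isHinf (isHinf_fourierLp zero_le_one) hx)
        (mulOp_mem_mulHardy_of_isHinf (isHinf_fourierLp zero_le_one) hy))
  have hdvd : ∀ {c : Linf}, IsInner c → mulOp c (fourierLp 2 0) ∈ M →
      InnerDvd (mulInf α φ) (mulInf α c) := by
    intro c hc hcM
    rw [hM] at hcM
    obtain ⟨d, hd, rfl⟩ := innerDvd_of_mulOp_mem hφ hc hcM
    exact ⟨d, hd, (mulInf_assoc _ _ _).symm⟩
  -- `α φ` divides both `α a` and `α b`, hence `α`; cancelling `α` leaves `φ w = 1`.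
  obtain ⟨w, hw, hαw⟩ := hmax _ (isInner_mulInf hα hφ) (hdvd ha haM) (hdvd hb hbM)
  have hone : (fourierLp 2 0 : L2) ∈ mulHardy φ := by
    refine ⟨mulOp w (fourierLp 2 0), isHinf_iff.mp hw.1, hα.mulOp_injective ?_⟩
    have := congrArg (fun u => mulOp u (fourierLp 2 0)) hαw
    simp only [mulOp_mulInf] at this
    exact this.symm
  have hstar : IsHinf (star φ) := isHinf_iff.mpr ((mem_mulHardy_iff hφ).mp hone)
  have hfM : f ∈ M := by
    rw [hM, mem_mulHardy_iff hφ]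
    exact mulOp_mem_hardy hstar hf
  have hle : M ≤ (ℂ ∙ v)ᗮ := by
    refine Submodule.topologicalClosure_minimal _ (sup_le ?_ ?_)
      (Submodule.isClosed_orthogonal _)
    · rintro _ ⟨h, hh, rfl⟩
      exact Submodule.mem_orthogonal_singleton_iff_inner_right.mpr
        (inner_mulOp_eq_zero_of_mem_hardy a hva hh)
    · rintro _ ⟨h, hh, rfl⟩
      exact Submodule.mem_orthogonal_singleton_iff_inner_right.mpr
        (inner_mulOp_eq_zero_of_mem_hardy b hvb hh)
  exact Submodule.mem_orthogonal_singleton_iff_inner_right.mp (hle hfM)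

theorem IsOuter.inner_eq_zero {g : Linf} (hg : IsOuter g) {v : L2}
    (hv : ∀ k : ℤ, 0 ≤ k → inner ℂ v (mulOp g (fourierLp 2 k)) = 0) {f : L2} (hf : f ∈ hardy) :
    inner ℂ v f = 0 := by
  have hle : hardy ≤ (ℂ ∙ v)ᗮ := by
    rw [← hg.2]
    refine Submodule.topologicalClosure_minimal _ (Submodule.span_le.mpr ?_)
      (Submodule.isClosed_orthogonal _)
    rintro _ ⟨n, rfl⟩
    exact Submodule.mem_orthogonal_singleton_iff_inner_right.mpr (hv n (Int.natCast_nonneg n))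
  exact Submodule.mem_orthogonal_singleton_iff_inner_right.mp (hle hf)

/-- An outer function cannot be used to cancel the antianalytic part of a function. -/
theorem IsOuter.mem_hardy {g : Linf} (hg : IsOuter g) {w : L2} (hw : mulOp g w ∈ hardy) :
    w ∈ hardy :=
  mem_hardy_of_mulOp_mem (S := {g}) (by simpa using hw) fun v hv =>
    hg.inner_eq_zero (hv g rfl) (fourierLp_mem_hardy le_rfl)

theorem IsInnerGcd.mem_hardy {α a b : Linf} (ha : IsInner a) (hb : IsInner b)
    (h : IsInnerGcd α (mulInf α a) (mulInf α b)) {w : L2} (hwa : mulOp a w ∈ hardy)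
    (hwb : mulOp b w ∈ hardy) : w ∈ hardy :=
  mem_hardy_of_mulOp_mem (S := {a, b}) (by simpa using ⟨hwa, hwb⟩) fun v hv =>
    h.inner_eq_zero ha hb (hv a (by simp)) (hv b (by simp)) (fourierLp_mem_hardy le_rfl)

/-! ### Model spaces and Toeplitz operators -/

theorem inner_eq_zero_of_mem_modelSpace {u : Linf} {x y : L2} (hx : x ∈ mulHardy u)
    (hy : y ∈ modelSpace u) : inner ℂ x y = 0 :=
  Submodule.inner_right_of_mem_orthogonal hx hy.2

/-- The decomposition `H² = K_u ⊕ u H²`. -/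
theorem exists_sub_mem_mulHardy {u : Linf} (hu : IsInner u) {h : L2} (hh : h ∈ hardy) :
    ∃ z ∈ modelSpace u, h - z ∈ mulHardy u := by
  have : CompleteSpace (mulHardy u) := (isClosed_mulHardy hu).completeSpace_coe
  have hp : (mulHardy u).starProjection h ∈ mulHardy u :=
    Submodule.starProjection_apply_mem (mulHardy u) h
  refine ⟨h - (mulHardy u).starProjection h,
    ⟨hardy.sub_mem hh (mulHardy_le_hardy hu.1 hp), ?_⟩, by rwa [sub_sub_cancel]⟩
  exact Submodule.sub_starProjection_mem_orthogonal h

/-- `K_ω` is the orthogonal complement of `ω H²` in `H²`, and `g f` stays in `H²`, so projecting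
means choosing the representative in `K_ω` modulo `ω H²`. -/
theorem toeplitz_apply_eq_iff {θ ω g : Linf} (hω : IsInner ω) (hg : IsHinf g)
    (f : modelSpace θ) (y : modelSpace ω) :
    toeplitz θ ω g f = y ↔ mulOp g f - y ∈ mulHardy ω := by
  have key : ∀ y : modelSpace ω, mulOp g f - y ∈ mulHardy ω → toeplitz θ ω g f = y := by
    intro y hy
    refine Subtype.ext (Submodule.eq_starProjection_of_mem_of_inner_eq_zero y.2 fun w hw => ?_)
    exact inner_eq_zero_of_mem_modelSpace hy hw
  refine ⟨?_, key y⟩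
  rintro rfl
  obtain ⟨z, hz, hgz⟩ := exists_sub_mem_mulHardy hω (mulOp_mem_hardy hg f.2.1)
  rwa [key ⟨z, hz⟩ hgz]

theorem toeplitz_apply_eq_zero_iff {θ ω g : Linf} (hω : IsInner ω) (hg : IsHinf g)
    (f : modelSpace θ) : toeplitz θ ω g f = 0 ↔ mulOp g f ∈ mulHardy ω := by
  simpa using toeplitz_apply_eq_iff hω hg f 0

/-! ### Kernel and closure of the range -/

theorem mulOp_mem_mulHardy_iff_of_isInnerGcd {α a b ge : Linf} (ha : IsInner a) (hb : IsInner b)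
    (h : IsInnerGcd α (mulInf α a) (mulInf α b)) (hge : IsOuter ge) {f : L2} (hf : f ∈ hardy) :
    mulOp (mulInf (mulInf α a) ge) f ∈ mulHardy (mulInf α b) ↔ f ∈ mulHardy b := by
  have hα := h.1
  constructor
  · rintro ⟨k, hk, hkf⟩
    have h1 : mulOp b k = mulOp a (mulOp ge f) := by
      refine hα.mulOp_injective ?_
      rw [← mulOp_mulInf, ← mulOp_mulInf, ← mulOp_mulInf]
      exact hkf
    rw [mem_mulHardy_iff hb]
    -- Take `w = conj b * f`: `b w = f` is in `H²`, and `ge a w = k` puts `a w` in `H²` by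
    -- outerness, so `w` is in `H²` by coprimality.
    refine h.mem_hardy ha hb (hge.mem_hardy ?_) (by rwa [hb.mulOp_mulOp_star])
    rw [mulOp_comm ge, mulOp_comm ge, mulOp_comm a, ← h1, hb.mulOp_star_mulOp]
    exact hk
  · rintro ⟨k, hk, rfl⟩
    refine ⟨mulOp a (mulOp ge k), mulOp_mem_hardy ha.1 (mulOp_mem_hardy hge.1 hk), ?_⟩
    change mulOp (mulInf α b) _ = mulOp _ (mulOp b k)
    rw [mulOp_mulInf, mulOp_mulInf, mulOp_mulInf, mulOp_comm ge b, mulOp_comm a b]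

theorem ker_toeplitz {θ ω g α a b ge : Linf} (ha : IsInner a) (hb : IsInner b)
    (hω : IsInner ω) (hg : IsHinf g) (hαω : ω = mulInf α b) (hαg : g = mulInf (mulInf α a) ge)
    (h : IsInnerGcd α (mulInf α a) (mulInf α b)) (hge : IsOuter ge) :
    (toeplitz θ ω g).toLinearMap.ker.map (modelSpace θ).subtype = modelSpace θ ⊓ mulHardy b := by
  have key : ∀ f : modelSpace θ, toeplitz θ ω g f = 0 ↔ (f : L2) ∈ mulHardy b := fun f => by
    rw [toeplitz_apply_eq_zero_iff hω hg]
    subst hαω hαg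
    exact mulOp_mem_mulHardy_iff_of_isInnerGcd ha hb h hge f.2.1
  ext f
  constructor
  · rintro ⟨f, hf, rfl⟩
    exact ⟨f.2, (key f).mp hf⟩
  · rintro ⟨hf, hfb⟩
    exact ⟨⟨f, hf⟩, (key ⟨f, hf⟩).mpr hfb, rfl⟩

theorem mulOp_mem_modelSpace {α b : Linf} (hα : IsInner α) {y : L2} (hy : y ∈ modelSpace b) :
    mulOp α y ∈ modelSpace (mulInf α b) := by
  refine ⟨mulOp_mem_hardy hα.1 hy.1, ?_⟩
  rintro _ ⟨h, hh, rfl⟩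
  change inner ℂ (mulOp (mulInf α b) h) _ = 0
  rw [mulOp_mulInf, hα.inner_mulOp]
  exact inner_eq_zero_of_mem_modelSpace (mulOp_mem_mulHardy b hh) hy

theorem isClosed_map_mulOp_modelSpace {α b : Linf} (hα : IsInner α) :
    IsClosed ((modelSpace b).map (mulOp α).toLinearMap : Set L2) := by
  have : ((modelSpace b).map (mulOp α).toLinearMap : Set L2) =
      mulOp (star α) ⁻¹' modelSpace b := by
    ext f
    constructor
    · rintro ⟨g, hg, rfl⟩
      simpa [hα.mulOp_star_mulOp] using hg
    · exact fun h => ⟨_, h, hα.mulOp_mulOp_star f⟩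
  rw [this]
  exact (isClosed_hardy.inter (mulHardy b).isClosed_orthogonal).preimage (mulOp _).continuous

/-- Multiplication by `α` is isometric and carries `K_b` into `K_{αb}` and `b H²` onto `α b H²`, so
it commutes with the projections; only density in `α K_b` needs an argument. -/
theorem topologicalClosure_range_toeplitz {θ α a b ge : Linf} (ha : IsInner a) (hb : IsInner b)
    (h : IsInnerGcd α (mulInf α a) (mulInf α b)) (hge : IsOuter ge)
    (hdense : (modelSpace θ ⊔ mulHardy b).topologicalClosure = hardy) :
    ((toeplitz θ (mulInf α b) (mulInf (mulInf α a) ge)).toLinearMap.range.map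
      (modelSpace (mulInf α b)).subtype).topologicalClosure =
      (modelSpace b).map (mulOp α).toLinearMap := by
  have hα := h.1
  have hω := isInner_mulInf hα hb
  have hg := isHinf_mulInf (isHinf_mulInf hα.1 ha.1) hge.1
  have hX : ∀ f : modelSpace θ, ∃ z ∈ modelSpace b,
      mulOp a (mulOp ge f) - z ∈ mulHardy b ∧
      (toeplitz θ (mulInf α b) (mulInf (mulInf α a) ge) f : L2) = mulOp α z := by
    intro f
    obtain ⟨z, hz, k, hk, hkz⟩ := exists_sub_mem_mulHardy hb
      (mulOp_mem_hardy ha.1 (mulOp_mem_hardy hge.1 f.2.1))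
    refine ⟨z, hz, ⟨k, hk, hkz⟩, congrArg Subtype.val
      ((toeplitz_apply_eq_iff hω hg f ⟨_, mulOp_mem_modelSpace hα hz⟩).mpr ⟨k, hk, ?_⟩)⟩
    change mulOp b k = _ at hkz
    change mulOp (mulInf α b) k = _
    rw [mulOp_mulInf, hkz, map_sub, mulOp_mulInf, mulOp_mulInf]
  set R := (toeplitz θ (mulInf α b) (mulInf (mulInf α a) ge)).toLinearMap.range.map
      (modelSpace (mulInf α b)).subtype
  have hle : R.topologicalClosure ≤ (modelSpace b).map (mulOp α).toLinearMap := by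
    refine Submodule.topologicalClosure_minimal _ ?_ (isClosed_map_mulOp_modelSpace hα)
    rintro _ ⟨_, ⟨f, rfl⟩, rfl⟩
    obtain ⟨z, hz, -, hfz⟩ := hX f
    exact ⟨z, hz, hfz.symm⟩
  have : CompleteSpace R.topologicalClosure :=
    (Submodule.isClosed_topologicalClosure R).completeSpace_coe
  rw [← Submodule.sup_orthogonal_inf_of_hasOrthogonalProjection hle, left_eq_sup]
  rintro _ ⟨hperp, y, hy, rfl⟩
  suffices hy0 : y = 0 by simp [hy0]
  -- `y` is orthogonal to `a ge f` for `f ∈ K_θ` by the choice of `y`, and for `f ∈ b H²` because `b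
  -- H²` is `H^∞`-invariant; the density hypothesis covers the rest of `H²`.
  have h1 : ∀ f ∈ hardy, inner ℂ (mulOp (star a) y) (mulOp ge f) = 0 := by
    have hsub : hardy ≤ (ℂ ∙ mulOp (star ge) (mulOp (star a) y))ᗮ := by
      rw [← hdense]
      refine Submodule.topologicalClosure_minimal _ (sup_le ?_ ?_)
        (Submodule.isClosed_orthogonal _) <;> intro f hf <;>
        rw [Submodule.mem_orthogonal_singleton_iff_inner_right, ← inner_mulOp_right,
          ← inner_mulOp_right]
      · obtain ⟨z, hz, hzb, hfz⟩ := hX ⟨f, hf⟩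
        have h2 : inner ℂ (mulOp α y) (mulOp α z) = 0 :=
          Submodule.inner_left_of_mem_orthogonal (K := R.topologicalClosure)
            (R.le_topologicalClosure ⟨_, ⟨⟨f, hf⟩, rfl⟩, hfz⟩) hperp
        rw [hα.inner_mulOp] at h2
        have h3 : inner ℂ y (mulOp a (mulOp ge f) - z) = 0 :=
          Submodule.inner_left_of_mem_orthogonal hzb hy.2
        rwa [inner_sub_right, h2, sub_zero] at h3
      · exact Submodule.inner_left_of_mem_orthogonal
          (mulOp_mem_mulHardy_of_isHinf ha.1 (mulOp_mem_mulHardy_of_isHinf hge.1 hf)) hy.2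
    intro f hf
    rw [inner_mulOp_right]
    exact Submodule.mem_orthogonal_singleton_iff_inner_right.mp (hsub hf)
  refine inner_self_eq_zero.mp
    (h.inner_eq_zero (v := y) ha hb (fun k hk => ?_) (fun k hk => ?_) hy.1)
  -- Outerness upgrades orthogonality to `a ge H²` to orthogonality to `a H²`.
  · rw [inner_mulOp_right]
    exact hge.inner_eq_zero (fun j hj => h1 _ (fourierLp_mem_hardy hj)) (fourierLp_mem_hardy hk)
  · exact Submodule.inner_left_of_mem_orthogonal
      (mulOp_mem_mulHardy b (fourierLp_mem_hardy hk)) hy.2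

/-! ### Surjectivity and invertibility -/

section Invertible

variable {θ ω g ginv : Linf}

theorem mulOp_mulOp_of_mul_eq_one (h : ∀ᵐ t ∂m, ginv t * g t = 1) (f : L2) :
    mulOp ginv (mulOp g f) = f := by
  refine Lp.ext ((coeFn_mulOp _ _).trans ?_)
  filter_upwards [h, coeFn_mulOp g f] with t h1 h2
  rw [h2, ← mul_assoc, h1, one_mul]

/-- Multiplying the congruence by `ginv`, or back by `g`, keeps it modulo `ω H²`. -/
theorem toeplitz_apply_eq_iff_of_mul_eq_one (hω : IsInner ω) (hg : IsHinf g)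
    (hginv : IsHinf ginv) (h : ∀ᵐ t ∂m, ginv t * g t = 1) (f : modelSpace θ) (y : modelSpace ω) :
    toeplitz θ ω g f = y ↔ mulOp ginv y - f ∈ mulHardy ω := by
  rw [toeplitz_apply_eq_iff hω hg, ← neg_mem_iff, neg_sub]
  constructor <;> intro hf
  · have := mulOp_mem_mulHardy_of_isHinf hginv hf
    rwa [map_sub, mulOp_mulOp_of_mul_eq_one h] at this
  · have := mulOp_mem_mulHardy_of_isHinf hg hf
    rwa [map_sub, mulOp_comm, mulOp_mulOp_of_mul_eq_one h] at this

theorem range_toeplitz_eq_top_iff (hω : IsInner ω) (hg : IsHinf g)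
    (hginv : IsHinf ginv) (h : ∀ᵐ t ∂m, ginv t * g t = 1) :
    (toeplitz θ ω g).toLinearMap.range = ⊤ ↔ modelSpace θ ⊔ mulHardy ω = hardy := by
  have hX := toeplitz_apply_eq_iff_of_mul_eq_one (θ := θ) hω hg hginv h
  rw [LinearMap.range_eq_top]
  constructor
  · refine fun hs => le_antisymm (sup_le inf_le_left (mulHardy_le_hardy hω.1)) fun x hx => ?_
    -- Modulo `ω H²`, `x` is `ginv y` with `y` the `K_ω` part of `g x`; a preimage `f` of `y` is
    -- then congruent to `x`.
    obtain ⟨y, hy, hxy⟩ := exists_sub_mem_mulHardy hω (mulOp_mem_hardy hg hx)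
    obtain ⟨f, hf⟩ := hs ⟨y, hy⟩
    have h1 := (hX f ⟨y, hy⟩).mp hf
    have h2 := mulOp_mem_mulHardy_of_isHinf hginv hxy
    rw [map_sub, mulOp_mulOp_of_mul_eq_one h] at h2
    refine Submodule.mem_sup.mpr ⟨f, f.2, x - f, ?_, add_sub_cancel _ _⟩
    simpa using add_mem h1 h2
  · intro hs y
    have hy := mulOp_mem_hardy hginv y.2.1
    rw [← hs] at hy
    obtain ⟨f, hf, k, hk, hfk⟩ := Submodule.mem_sup.mp hy
    exact ⟨⟨f, hf⟩, (hX ⟨f, hf⟩ y).mpr (by rwa [← hfk, add_sub_cancel_left])⟩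

theorem isDirectDecomp_iff (hω : IsInner ω) :
    IsDirectDecomp θ ω ↔
      modelSpace θ ⊓ mulHardy ω = ⊥ ∧ modelSpace θ ⊔ mulHardy ω = hardy := by
  have hθle : modelSpace θ ≤ hardy := inf_le_left
  have hωle := mulHardy_le_hardy hω.1
  rw [IsDirectDecomp, isCompl_iff]
  refine and_congr ?_ ?_
  · rw [Submodule.disjoint_def, Submodule.eq_bot_iff]
    exact ⟨fun h x hx => congrArg Subtype.val (h ⟨x, hθle hx.1⟩ hx.1 hx.2),
      fun h x hx hx' => Subtype.ext (h x ⟨hx, hx'⟩)⟩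
  · rw [Submodule.codisjoint_iff_exists_add_eq]
    constructor
    · refine fun h => le_antisymm (sup_le hθle hωle) fun x hx => ?_
      obtain ⟨y, z, hy, hz, hyz⟩ := h ⟨x, hx⟩
      exact Submodule.mem_sup.mpr ⟨y, hy, z, hz, congrArg Subtype.val hyz⟩
    · intro h x
      obtain ⟨y, hy, z, hz, hyz⟩ := Submodule.mem_sup.mp (h.ge x.2)
      exact ⟨⟨y, hθle hy⟩, ⟨z, hωle hz⟩, hy, hz, Subtype.ext hyz⟩

theorem isInvertible_toeplitz_iff (hω : IsInner ω) (hg : IsHinf g)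
    (hginv : IsHinf ginv) (h : ∀ᵐ t ∂m, ginv t * g t = 1) :
    (toeplitz θ ω g).IsInvertible ↔ IsDirectDecomp θ ω := by
  have hker : (toeplitz θ ω g).toLinearMap.ker = ⊥ ↔ modelSpace θ ⊓ mulHardy ω = ⊥ := by
    have hX : ∀ f : modelSpace θ, toeplitz θ ω g f = 0 ↔ (f : L2) ∈ mulHardy ω := fun f => by
      rw [toeplitz_apply_eq_iff_of_mul_eq_one hω hg hginv h]
      simp
    rw [Submodule.eq_bot_iff, Submodule.eq_bot_iff]
    exact ⟨fun hk x hx => congrArg Subtype.val (hk ⟨x, hx.1⟩ ((hX ⟨x, hx.1⟩).mpr hx.2)),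
      fun hk x hx => Subtype.ext (hk x ⟨x.2, (hX x).mp hx⟩)⟩
  rw [isDirectDecomp_iff hω, ← hker, ← range_toeplitz_eq_top_iff hω hg hginv h]
  constructor
  · exact fun hi => ⟨LinearMap.ker_eq_bot.mpr hi.injective,
      LinearMap.range_eq_top.mpr hi.surjective⟩
  -- Boundedness of the inverse is the open mapping theorem.
  · exact fun ⟨hk, hr⟩ => ⟨ContinuousLinearEquiv.ofBijective _ hk hr,
      ContinuousLinearEquiv.coe_ofBijective _ hk hr⟩

theorem inverse_toeplitz_apply (hω : IsInner ω) (hg : IsHinf g)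
    (hginv : IsHinf ginv) (h : ∀ᵐ t ∂m, ginv t * g t = 1) (hd : IsDirectDecomp θ ω)
    (y : modelSpace ω) (hy : mulOp ginv y ∈ hardy) :
    ((toeplitz θ ω g).inverse y : L2) = skewProj hd ⟨mulOp ginv y, hy⟩ := by
  -- `inverse` is zero by default on non-invertible operators; `hi` makes it the genuine inverse.
  have hi := (isInvertible_toeplitz_iff hω hg hginv h).mpr hd
  have hy' := (toeplitz_apply_eq_iff_of_mul_eq_one hω hg hginv h _ y).mp (hi.self_apply_inverse y)
  set f := (toeplitz θ ω g).inverse y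
  have hsum : (⟨mulOp ginv y, hy⟩ : hardy) =
      ⟨f, f.2.1⟩ + ⟨mulOp ginv y - f, mulHardy_le_hardy hω.1 hy'⟩ :=
    Subtype.ext (add_sub_cancel _ _).symm
  have hf : skewProj hd ⟨f, f.2.1⟩ = ⟨f, f.2.1⟩ :=
    Submodule.projection_apply_of_mem_left hd f.2
  have hr : skewProj hd ⟨mulOp ginv y - f, mulHardy_le_hardy hω.1 hy'⟩ = 0 :=
    Submodule.projection_apply_of_mem_right hd hy'
  rw [hsum, map_add, hf, hr, add_zero]

end Invertible

end ModelSpaces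

theorem lemma6p3 (θ ω g : ModelSpaces.Linf)
    (hθ : ModelSpaces.IsInner θ) (hω : ModelSpaces.IsInner ω) (hg : ModelSpaces.IsHinf g) :
    (∀ gi α : ModelSpaces.Linf, ModelSpaces.IsInnerFactor gi g → ModelSpaces.IsInnerGcd α gi ω →
      (ModelSpaces.toeplitz θ ω g).toLinearMap.ker.map (ModelSpaces.modelSpace θ).subtype =
          ModelSpaces.modelSpace θ ⊓ ModelSpaces.mulHardy (ModelSpaces.mulInf (star α) ω) ∧
      ((ModelSpaces.modelSpace θ ⊔
            ModelSpaces.mulHardy (ModelSpaces.mulInf (star α) ω)).topologicalClosure =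
          ModelSpaces.hardy →
        (((ModelSpaces.toeplitz θ ω g).toLinearMap.range.map
            (ModelSpaces.modelSpace ω).subtype).topologicalClosure =
          (ModelSpaces.modelSpace (ModelSpaces.mulInf (star α) ω)).map
            (ModelSpaces.mulOp α).toLinearMap))) ∧
    (∀ ginv : ModelSpaces.Linf, ModelSpaces.IsHinf ginv →
      (∀ᵐ t ∂ModelSpaces.m, ginv t * g t = 1) →
      ((ModelSpaces.toeplitz θ ω g).toLinearMap.range = ⊤ ↔
        ModelSpaces.modelSpace θ ⊔ ModelSpaces.mulHardy ω = ModelSpaces.hardy) ∧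
      ((ModelSpaces.toeplitz θ ω g).IsInvertible ↔ ModelSpaces.IsDirectDecomp θ ω) ∧
      (∀ hd : ModelSpaces.IsDirectDecomp θ ω, ∀ f : ModelSpaces.modelSpace ω,
        ∃ hf : ModelSpaces.mulOp ginv f ∈ ModelSpaces.hardy,
          (((ModelSpaces.toeplitz θ ω g).inverse f : ModelSpaces.modelSpace θ) : ModelSpaces.L2) =
            ModelSpaces.skewProj hd ⟨ModelSpaces.mulOp ginv f, hf⟩)) := by
  open ModelSpaces in
  refine ⟨fun gi α hgi hα => ?_, fun ginv hginv h => ⟨?_, ?_, fun hd f => ?_⟩⟩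
  · obtain ⟨-, ge, hge, rfl⟩ := hgi
    have hgcd := hα
    obtain ⟨hαi, ⟨a, ha, rfl⟩, ⟨b, hb, rfl⟩, -⟩ := hα
    -- With `ω = α b`, the quotient `conj α * ω` is `b`.
    rw [hαi.star_mulInf_cancel]
    exact ⟨ker_toeplitz ha hb hω hg rfl rfl hgcd hge,
      topologicalClosure_range_toeplitz ha hb hgcd hge⟩
  · exact range_toeplitz_eq_top_iff hω hg hginv h
  · exact isInvertible_toeplitz_iff hω hg hginv h
  · exact ⟨mulOp_mem_hardy hginv f.2.1, inverse_toeplitz_apply hω hg hginv h hd f _⟩
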